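/- Let $\mathbb F$ be any field, let $n\ge 0$, let $N_1,\dots,N_n\ge 1$ be integers, and let $\lambda_{i,j}^k\in\mathbb F$ for $1\le i,j\le n$, $j\ne i$, $0\le k\le N_i-1$. Put $$A=\mathbb F[x_1,\dots,x_n]\Big/\Big\langle x_i\prod_{k=0}^{N_i-1}\Big(x_i-\sum_{j\ne i}\lambda_{i,j}^k x_j\Big)\ \Big|\ 1\le i\le n\Big\rangle .$$ In the polynomial ring $\mathbb F[Z_{i,k}\mid 1\le i\le n,\ 1\le k\le N_i]$ define the linear forms $$L_{i,N_i}=Z_{i,1}+\cdots+Z_{i,N_i-1}-Z_{i,N_i}+\sum_{j\ne i}\lambda_{i,j}^0Z_{j,N_j},$$ $$L_{i,k}=Z_{i,1}+\cdots+Z_{i,k}-\sum_{j\ne i}\big(\lambda_{i,j}^{N_i-k}-\lambda_{i,j}^0\big)Z_{j,N_j}\qquad(1\le k\le N_i-1),$$ and let $\hat A=\mathbb F[Z_{i,k}]\big/\big\langle Z_{i,k}L_{i,k}\mid 1\le i\le n,\ 1\le k\le N_i\big\rangle$. Both algebras carry the standard grading (all variables have degree $1$). The socle of such an algebra is the annihilator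 of the ideal generated by the variables, and a socle generator is a nonzero element $s$ such that the socle equals $\mathbb F s$. There is an $\mathbb F$-algebra homomorphism $\phi\colon A\to\hat A$ with $\phi(x_i)=Z_{i,N_i}$ for $1\le i\le n$. If $A$ is Artinian, then: 1. $\hat A$ is Artinian, and it is a quadratic complete intersection: the quadratic forms $Z_{i,k}L_{i,k}$, as many as there are variables, form a regular sequence in any order; 2. $\prod_{i=1}^n\prod_{k=1}^{N_i}L_{i,k}$ is a socle generator of $\hat A$; 3. $\phi$ is an embedding, that is, it is a graded homomorphism, $A$ has a socle generator, and $\phi$ maps some socle generator of $A$ to a socle generator of $\hat A$; more precisely, $\phi$ maps every socle generator of $A$ to a nonzero scalar multiple of $\prod_{i,k}L_{i,k}$. In particular $\phi$ is injective. -/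

import Mathlib

noncomputable section

open MvPolynomial

namespace SplitCI

/-! ### Standard graded quotients of polynomial rings -/

section General

variable {F : Type*} [Field F] {σ τ : Type*}

/-- The degree `d` part of the quotient `F[x_s : s ∈ σ] / I` for the standard grading:
the classes of the homogeneous polynomials of degree `d`. -/
def gradedPiece (I : Ideal (MvPolynomial σ F)) (d : ℕ) : Submodule F (MvPolynomial σ F ⧸ I) :=
  (homogeneousSubmodule σ F d).map (Ideal.Quotient.mkₐ F I).toLinearMap

/-- The homogeneous maximal ideal of `F[x_s : s ∈ σ] / I`, generated by the classes of the
variables. -/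
def irrelevant (I : Ideal (MvPolynomial σ F)) : Ideal (MvPolynomial σ F ⧸ I) :=
  Ideal.span (Set.range fun s : σ => Ideal.Quotient.mk I (X s))

/-- The socle `(0 : 𝔪)` of `F[x_s : s ∈ σ] / I`: all elements that are annihilated by the
homogeneous maximal ideal `𝔪`, as a subspace over `F`. -/
def socle (I : Ideal (MvPolynomial σ F)) : Submodule F (MvPolynomial σ F ⧸ I) where
  carrier := {a | ∀ m ∈ irrelevant I, m * a = 0}
  zero_mem' := fun m _ => mul_zero m
  add_mem' := fun {a b} ha hb m hm => by rw [mul_add, ha m hm, hb m hm, add_zero]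
  smul_mem' := fun c a ha m hm => by rw [mul_smul_comm, ha m hm, smul_zero]

/-- `s` is a socle generator: the socle is the one-dimensional space spanned by `s`. -/
def IsSocleGenerator {I : Ideal (MvPolynomial σ F)} (s : MvPolynomial σ F ⧸ I) : Prop :=
  s ≠ 0 ∧ socle I = Submodule.span F {s}

/-- An embedding of graded algebras: a graded `F`-algebra homomorphism that maps a socle
generator to a socle generator. -/
def IsEmbedding {I : Ideal (MvPolynomial σ F)} {J : Ideal (MvPolynomial τ F)}
    (φ : (MvPolynomial σ F ⧸ I) →ₐ[F] (MvPolynomial τ F ⧸ J)) : Prop :=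
  (∀ d : ℕ, ∀ a ∈ gradedPiece I d, φ a ∈ gradedPiece J d) ∧
    ∃ s : MvPolynomial σ F ⧸ I, IsSocleGenerator s ∧ IsSocleGenerator (φ s)

/-- A regular sequence (of full length) in a polynomial ring: as many homogeneous polynomials of
positive degree as there are variables, each one a non-zero-divisor modulo the preceding ones. -/
def IsRegularSequence [Fintype σ] (fs : List (MvPolynomial σ F)) : Prop :=
  fs.length = Fintype.card σ ∧ (∀ f ∈ fs, ∃ d : ℕ, 0 < d ∧ f.IsHomogeneous d) ∧
    RingTheory.Sequence.IsRegular (MvPolynomial σ F) fs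

/-- The quotient by the polynomials `f p`, `p ∈ σ`, is a quadratic complete intersection: the
`f p` are quadratic forms, and listed in any order they form a regular sequence. -/
def IsQuadraticCompleteIntersection [Fintype σ] (f : σ → MvPolynomial σ F) : Prop :=
  (∀ p, (f p).IsHomogeneous 2) ∧
    ∀ l : List σ, l.Nodup → (∀ p, p ∈ l) → IsRegularSequence (l.map f)

end General

/-! ### The split algebra `A` in normal form

The scalar `λ_{i,j}^k` is `lam i k j`; only the values with `k < N i` and `j ≠ i` are used. -/

variable {F : Type*} [Field F] {n : ℕ}

/-- The product of linear forms
`f_i = x_i * ∏_{k = 0}^{N_i - 1} (x_i - ∑_{j ≠ i} λ_{i,j}^k x_j)`. -/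
def splitForm (N : Fin n → ℕ) (lam : Fin n → ℕ → Fin n → F) (i : Fin n) :
    MvPolynomial (Fin n) F :=
  X i * ∏ k ∈ Finset.range (N i), (X i - ∑ j ∈ Finset.univ.erase i, C (lam i k j) * X j)

/-- The ideal of relations of `A`. -/
def splitIdeal (N : Fin n → ℕ) (lam : Fin n → ℕ → Fin n → F) : Ideal (MvPolynomial (Fin n) F) :=
  Ideal.span (Set.range (splitForm N lam))

/-- The algebra `A = F[x_1, …, x_n] / (f_1, …, f_n)`. -/
abbrev SplitAlgebra (N : Fin n → ℕ) (lam : Fin n → ℕ → Fin n → F) : Type _ :=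
  MvPolynomial (Fin n) F ⧸ splitIdeal N lam

/-! ### The quadratic algebra `Â` -/

/-- Index set of the variables `Z_{i,k}`, `1 ≤ k ≤ N_i`. Positions start at `0`, so the variable
`Z_{i,k}` has index `⟨i, k - 1⟩`. -/
abbrev ZIndex (N : Fin n → ℕ) : Type := Σ i : Fin n, Fin (N i)

/-- The index of the last variable `Z_{i,N_i}`. -/
def lastIndex (N : Fin n → ℕ) (hN : ∀ i, 0 < N i) (i : Fin n) : ZIndex N :=
  ⟨i, ⟨N i - 1, Nat.sub_lt (hN i) Nat.one_pos⟩⟩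

/-- The linear forms `L_{i,k}`. For `k = N_i` this is
`Z_{i,1} + ⋯ + Z_{i,N_i-1} - Z_{i,N_i} + ∑_{j ≠ i} λ_{i,j}^0 Z_{j,N_j}`, and for `k < N_i` it is
`Z_{i,1} + ⋯ + Z_{i,k} - ∑_{j ≠ i} (λ_{i,j}^{N_i-k} - λ_{i,j}^0) Z_{j,N_j}`.
Here `p = ⟨i, k - 1⟩` in the indexing of `ZIndex`. -/
def linForm (N : Fin n → ℕ) (hN : ∀ i, 0 < N i) (lam : Fin n → ℕ → Fin n → F) (p : ZIndex N) :
    MvPolynomial (ZIndex N) F :=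
  if (p.2 : ℕ) + 1 = N p.1 then
    (∑ m ∈ Finset.Iio p.2, X ⟨p.1, m⟩) - X (lastIndex N hN p.1)
      + ∑ j ∈ Finset.univ.erase p.1, C (lam p.1 0 j) * X (lastIndex N hN j)
  else
    (∑ m ∈ Finset.Iic p.2, X ⟨p.1, m⟩)
      - ∑ j ∈ Finset.univ.erase p.1,
          C (lam p.1 (N p.1 - ((p.2 : ℕ) + 1)) j - lam p.1 0 j) * X (lastIndex N hN j)

/-- The quadratic relations `Z_{i,k} * L_{i,k}` of `Â`. -/
def quadForm (N : Fin n → ℕ) (hN : ∀ i, 0 < N i) (lam : Fin n → ℕ → Fin n → F) (p : ZIndex N) :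
    MvPolynomial (ZIndex N) F :=
  X p * linForm N hN lam p

/-- The ideal of relations of `Â`. -/
def quadIdeal (N : Fin n → ℕ) (hN : ∀ i, 0 < N i) (lam : Fin n → ℕ → Fin n → F) :
    Ideal (MvPolynomial (ZIndex N) F) :=
  Ideal.span (Set.range (quadForm N hN lam))

/-- The algebra `Â = F[Z_{i,k}] / (Z_{i,k} * L_{i,k})`. -/
abbrev QuadAlgebra (N : Fin n → ℕ) (hN : ∀ i, 0 < N i) (lam : Fin n → ℕ → Fin n → F) : Type _ :=
  MvPolynomial (ZIndex N) F ⧸ quadIdeal N hN lam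

/-- The class in `Â` of the product of all the linear forms `L_{i,k}`. -/
def prodLinForm (N : Fin n → ℕ) (hN : ∀ i, 0 < N i) (lam : Fin n → ℕ → Fin n → F) :
    QuadAlgebra N hN lam :=
  Ideal.Quotient.mk (quadIdeal N hN lam) (∏ p : ZIndex N, linForm N hN lam p)

end SplitCI

end

/-!
The proof rests on the fact that all relations are products of linear forms.

*Regularity.* If `A` is Artinian, comparing degrees shows that the `x_i` are nilpotent in `A`, hence
so are the `Z_{i,N_i}` in `Â`, and the quadratic relations make the other `Z_{i,k}` nilpotent one
after the other. So the relations have no common zero except the origin. Choosing one linear factor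
from each relation therefore gives linearly independent forms, which are a regular sequence in every
order, and regularity passes from factors to products (`IsRegularFamily.of_closure`). This applies
to the relations of `A` and of `Â` (`isSplitRegular_splitCofactor`, `isSplitRegular_linForm`), also
after replacing some relations by a factor.

*Socles.* For relations `X p * g p` that are regular in this sense, the annihilator of `X p` modulo
`X p * g p` is generated by `g p`; doing this for one `p` after the other shows that `∏ p, g p`
generates the socle (`IsSplitRegular.isSocleGenerator`), and that its degree is the top degree
(`IsSplitRegular.mem_of_lt_degree`).

*The map `φ`.* In terms of the partial sums `S_k = Z_{i,1} + ⋯ + Z_{i,k}` the quadratic relations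
say `(S_k - S_{k-1}) * (S_k - a_k) = 0` and `x * (w - S_{N-1}) = 0`, with `x = Z_{i,N_i}`. These
imply `x * w * ∏ (w - a_k) = 0`, which is the relation of `A`, so `φ` exists. It is always
injective: if `x * P(w) = 0` with `P` monic, a root `t` of `P` with `x * (w - t) = 0` exists in an
extension of the base ring (`exists_adjoin_root`), and adjoining `S_{N-1}, …, S_1` in this way gives
an extension of `A` to which `Â` maps (`mem_splitIdeal_of_lastRename_mem`).

The socle generators of `A` and of `Â` both have degree `∑ N_i`. So `φ` maps the first one to a
nonzero element of the top degree of `Â`, a nonzero multiple of the second one.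
-/

namespace SplitCI

open MvPolynomial

/-! ### Regular families and products -/

section Regularity

variable {R : Type*} [CommRing R]

/-- `c` is a non-zero-divisor modulo the ideal `K`. The ideal may be the whole ring. -/
def RegularMod (K : Ideal R) (c : R) : Prop := ∀ h, c * h ∈ K → h ∈ K

theorem RegularMod.one (K : Ideal R) : RegularMod K 1 := fun h hh => by simpa using hh

theorem RegularMod.top (c : R) : RegularMod (⊤ : Ideal R) c := fun _ _ => Submodule.mem_top

theorem RegularMod.mul {K : Ideal R} {b c : R} (hb : RegularMod K b) (hc : RegularMod K c) :
    RegularMod K (b * c) := fun h hh => hc h (hb _ (by rwa [mul_assoc] at hh))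

theorem RegularMod.span_mul_sup {K : Ideal R} {a b c : R} (ha : RegularMod K a)
    (hca : RegularMod (Ideal.span {a} ⊔ K) c) (hcb : RegularMod (Ideal.span {b} ⊔ K) c) :
    RegularMod (Ideal.span {a * b} ⊔ K) c := by
  intro h hh
  obtain ⟨v, k, hk, hv⟩ := Ideal.mem_span_singleton_sup.1 hh
  obtain ⟨u, k', hk', hu⟩ := Ideal.mem_span_singleton_sup.1
    (hca h (Ideal.mem_span_singleton_sup.2 ⟨v * b, k, hk, by rw [← hv]; ring⟩))
  -- Here `h = u * a + k'`, so `a * (c * u - b * v) ∈ K`, and `a` may be cancelled.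
  have h1 : c * u - b * v ∈ K := by
    apply ha
    have : a * (c * u - b * v) = k - c * k' := by linear_combination c * hu - hv
    rw [this]
    exact K.sub_mem hk (K.mul_mem_left _ hk')
  obtain ⟨t, k'', hk'', ht⟩ := Ideal.mem_span_singleton_sup.1
    (hcb u (Ideal.mem_span_singleton_sup.2 ⟨v, _, h1, by ring⟩))
  refine Ideal.mem_span_singleton_sup.2 ⟨t, a * k'' + k', K.add_mem (K.mul_mem_left _ hk'') hk', ?_⟩
  rw [← hu, ← ht]; ring

/-- Each `f j` is a non-zero-divisor modulo any set of other members of the family, that is, `f`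
is a regular sequence in every order, except that the ideals may be the whole ring. -/
def IsRegularFamily {ι : Type*} (f : ι → R) : Prop :=
  ∀ (T : Set ι) (j : ι), j ∉ T → RegularMod (Ideal.span (f '' T)) (f j)

theorem span_image_eq_of_mem {ι : Type*} (f : ι → R) {T : Set ι} {i : ι} (hi : i ∈ T) :
    Ideal.span (f '' T) = Ideal.span {f i} ⊔ Ideal.span (f '' (T \ {i})) := by
  rw [← Ideal.span_insert, ← Set.image_insert_eq, Set.insert_sdiff_singleton,
    Set.insert_eq_of_mem hi]

theorem span_image_update_of_notMem {ι : Type*} [DecidableEq ι] (f : ι → R) {T : Set ι} {i : ι}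
    (hi : i ∉ T) (b : R) :
    Ideal.span (Function.update f i b '' T) = Ideal.span (f '' T) := by
  congr 1
  exact Set.image_congr fun x hx => Function.update_of_ne (ne_of_mem_of_not_mem hx hi) _ _

/-- Regularity passes from factors to products: if every choice of one element in each `G i` is a
regular family, so is every family of products of elements of the `G i`. -/
theorem IsRegularFamily.of_closure {ι : Type*} [Finite ι] {G : ι → Set R}
    (hne : ∀ i, (G i).Nonempty)
    (hG : ∀ χ : ι → R, (∀ i, χ i ∈ G i) → IsRegularFamily χ)
    (f : ι → R) (hf : ∀ i, f i ∈ Submonoid.closure (G i)) : IsRegularFamily f := by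
  classical
  cases nonempty_fintype ι
  -- The indices where products are allowed are enlarged one at a time.
  suffices H : ∀ (U : Finset ι) (f : ι → R), (∀ i ∈ U, f i ∈ Submonoid.closure (G i)) →
      (∀ i ∉ U, f i ∈ G i) → IsRegularFamily f from
    H Finset.univ f (fun i _ => hf i) (fun i hi => absurd (Finset.mem_univ i) hi)
  intro U
  induction U using Finset.induction_on with
  | empty => exact fun f _ hf => hG f fun i => hf i (by simp)
  | insert i U hi ih =>
    intro f hf1 hf2
    have base : ∀ b ∈ G i, IsRegularFamily (Function.update f i b) := by
      intro b hb
      apply ih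
      · intro j hj
        rw [Function.update_of_ne (by rintro rfl; exact hi hj)]
        exact hf1 j (Finset.mem_insert_of_mem hj)
      · intro j hj
        by_cases hji : j = i
        · subst hji; simpa using hb
        · rw [Function.update_of_ne hji]
          exact hf2 j (by simp [hji, hj])
    suffices H : ∀ b ∈ Submonoid.closure (G i), IsRegularFamily (Function.update f i b) by
      simpa using H (f i) (hf1 i (Finset.mem_insert_self _ _))
    intro b hb
    induction hb using Submonoid.closure_induction with
    | mem b hb => exact base b hb
    | one =>
      intro T j hj
      by_cases hji : j = i
      · subst hji; simpa using RegularMod.one _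
      by_cases hiT : i ∈ T
      · rw [span_image_eq_of_mem _ hiT]
        simpa using RegularMod.top _
      · obtain ⟨b, hb⟩ := hne i
        have := base b hb T j hj
        rwa [Function.update_of_ne hji, span_image_update_of_notMem _ hiT] at this ⊢
    | mul a b _ _ iha ihb =>
      intro T j hj
      by_cases hji : j = i
      · subst hji
        have h1 := iha T j hj
        have h2 := ihb T j hj
        rw [Function.update_self, span_image_update_of_notMem _ hj] at h1 h2 ⊢
        exact h1.mul h2
      have h1 := iha T j hj
      have h2 := ihb T j hj
      by_cases hiT : i ∈ T
      · have h3 := iha (T \ {i}) i (by simp)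
        rw [Function.update_self, span_image_update_of_notMem _ (by simp)] at h3
        rw [Function.update_of_ne hji, span_image_eq_of_mem _ hiT, Function.update_self,
          span_image_update_of_notMem _ (by simp)] at h1 h2 ⊢
        exact h3.span_mul_sup h1 h2
      · rwa [Function.update_of_ne hji, span_image_update_of_notMem _ hiT] at h1 ⊢

end Regularity

/-! ### Linear forms -/

section Linear

variable {F : Type*} [Field F] {σ : Type*}

theorem isRegularFamily_X : IsRegularFamily (X : σ → MvPolynomial σ F) := by
  intro T j hj h hh
  rw [mem_ideal_span_X_image] at hh ⊢
  intro m hm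
  obtain ⟨i, hi, hmi⟩ := hh (Finsupp.single j 1 + m) (by
    rw [mem_support_iff] at hm ⊢
    rwa [coeff_X_mul])
  refine ⟨i, hi, ?_⟩
  have : i ≠ j := fun h => hj (h ▸ hi)
  simpa [Finsupp.single_apply, this.symm] using hmi

/-- As many linear forms as variables, without a common zero other than the origin, are the
images of the variables under a linear change of coordinates, hence a regular family. -/
theorem isRegularFamily_of_linear [Fintype σ] (χ : σ → MvPolynomial σ F)
    (hlin : ∀ p, χ p ∈ Submodule.span F (Set.range (X : σ → MvPolynomial σ F)))
    (hrad : ∀ p, X p ∈ (Ideal.span (Set.range χ)).radical) : IsRegularFamily χ := by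
  classical
  choose M hM using fun p => (Submodule.mem_span_range_iff_exists_fun F).1 (hlin p)
  have hdet : (Matrix.of M).det ≠ 0 := by
    intro h0
    obtain ⟨v, hv, hMv⟩ := Matrix.exists_mulVec_eq_zero_iff.2 h0
    -- The point `v` is a common zero of the forms, so all coordinates of `v` are nilpotent.
    have hker : Ideal.span (Set.range χ) ≤ RingHom.ker (aeval v : MvPolynomial σ F →ₐ[F] F) := by
      rw [Ideal.span_le]
      rintro _ ⟨p, rfl⟩
      have := congrFun hMv p
      simpa [← hM, Matrix.mulVec, dotProduct] using this
    apply hv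
    funext p
    obtain ⟨k, hk⟩ := hrad p
    have := hker hk
    simp only [RingHom.mem_ker, map_pow, aeval_X] at this
    exact eq_zero_of_pow_eq_zero this
  have hu : IsUnit (Matrix.of M).det := hdet.isUnit
  let e : MvPolynomial σ F →ₐ[F] MvPolynomial σ F := aeval χ
  let e' : MvPolynomial σ F →ₐ[F] MvPolynomial σ F :=
    aeval fun p => ∑ q, (Matrix.of M)⁻¹ p q • X q
  have h1 : e.comp e' = AlgHom.id F _ := by
    ext1 p
    simp only [e, e', AlgHom.comp_apply, aeval_X, map_sum, map_smul, ← hM, Finset.smul_sum,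
      smul_smul, AlgHom.id_apply]
    rw [Finset.sum_comm]
    simp only [← Finset.sum_smul]
    have : ∀ q, ∑ r, (Matrix.of M)⁻¹ p r * M r q = (1 : Matrix σ σ F) p q := fun q => by
      rw [← Matrix.nonsing_inv_mul _ hu]; simp [Matrix.mul_apply]
    simp [this, Matrix.one_apply]
  have h2 : e'.comp e = AlgHom.id F _ := by
    ext1 p
    simp only [e, e', AlgHom.comp_apply, aeval_X, map_sum, map_smul, ← hM, Finset.smul_sum,
      smul_smul, AlgHom.id_apply]
    rw [Finset.sum_comm]
    simp only [← Finset.sum_smul]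
    have : ∀ q, ∑ r, M p r * (Matrix.of M)⁻¹ r q = (1 : Matrix σ σ F) p q := fun q => by
      rw [← Matrix.mul_nonsing_inv _ hu]; simp [Matrix.mul_apply]
    simp [this, Matrix.one_apply]
  have heX : ∀ p, e (X p) = χ p := fun p => aeval_X _ _
  have he'χ : ∀ p, e' (χ p) = X p := fun p => by
    rw [← heX]; exact DFunLike.congr_fun h2 (X p)
  intro T j hj h hh
  have hmap : ∀ y ∈ Ideal.span (χ '' T), e' y ∈ Ideal.span (X '' T) := by
    intro y hy
    have := Ideal.mem_map_of_mem e' hy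
    rwa [Ideal.map_span, Set.image_image, Set.image_congr fun p _ => he'χ p] at this
  have h3 := hmap _ hh
  rw [map_mul, he'χ] at h3
  have h4 := Ideal.mem_map_of_mem e (isRegularFamily_X T j hj _ h3)
  rw [Ideal.map_span, Set.image_image, Set.image_congr fun p _ => heX p] at h4
  rwa [show e (e' h) = h from DFunLike.congr_fun h1 h] at h4

end Linear

/-! ### Graded Artinian quotients -/

section Homogeneous

variable {F : Type*} [Field F] {σ : Type*}

theorem homogeneousComponent_mem_span_range {f : σ → MvPolynomial σ F}
    (hf : ∀ p, ∃ d, (f p).IsHomogeneous d) {y : MvPolynomial σ F}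
    (hy : y ∈ Ideal.span (Set.range f)) (e : ℕ) :
    homogeneousComponent e y ∈ Ideal.span (Set.range f) := by
  let _ : GradedAlgebra (homogeneousSubmodule σ F) := MvPolynomial.gradedAlgebra
  refine homogeneousComponent_mem_of_mem (Ideal.homogeneous_span _ _ ?_) hy e
  rintro _ ⟨p, rfl⟩
  obtain ⟨d, hd⟩ := hf p
  exact ⟨d, (mem_homogeneousSubmodule d _).2 hd⟩

/-- In an Artinian graded quotient the variables are nilpotent: the decreasing chain of ideals
`(x_p ^ k)` is stationary, and comparing degrees in `x_p ^ k = x_p ^ (k + 1) * b` gives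
`x_p ^ k = 0`. -/
theorem X_mem_radical_of_isArtinianRing {f : σ → MvPolynomial σ F}
    (hf : ∀ p, ∃ d, (f p).IsHomogeneous d)
    [IsArtinianRing (MvPolynomial σ F ⧸ Ideal.span (Set.range f))] (p : σ) :
    X p ∈ (Ideal.span (Set.range f)).radical := by
  obtain ⟨k, y, hy⟩ := IsArtinian.exists_pow_succ_smul_dvd
    (M := MvPolynomial σ F ⧸ Ideal.span (Set.range f))
    (Ideal.Quotient.mk (Ideal.span (Set.range f)) (X p)) 1
  obtain ⟨b, rfl⟩ := Ideal.Quotient.mk_surjective y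
  rw [smul_eq_mul, smul_eq_mul, ← map_pow, ← map_pow, mul_one, ← map_mul, Ideal.Quotient.eq] at hy
  refine ⟨k, ?_⟩
  have h := homogeneousComponent_mem_span_range hf hy k
  have h1 : homogeneousComponent k (X p ^ (k + 1) * b) = 0 := by
    ext d
    rw [coeff_homogeneousComponent, coeff_zero]
    split_ifs with hd
    · have : X p ^ (k + 1) * b ∈ idealOfVars σ F ^ (k + 1) :=
        Ideal.mul_mem_right _ _ (Ideal.pow_mem_pow (Ideal.subset_span (Set.mem_range_self p)) _)
      exact (mem_pow_idealOfVars_iff' _ _).1 this d (by omega)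
    · rfl
  rw [map_sub, h1, zero_sub,
    homogeneousComponent_eq_self (by simpa using isHomogeneous_X_pow p k)] at h
  exact (Ideal.neg_mem_iff _).1 h

theorem isArtinianRing_of_X_mem_radical [Finite σ] {I : Ideal (MvPolynomial σ F)}
    (h : ∀ p, X p ∈ I.radical) : IsArtinianRing (MvPolynomial σ F ⧸ I) := by
  have hint : Algebra.IsIntegral F (MvPolynomial σ F ⧸ I) := by
    constructor
    intro y
    obtain ⟨y, rfl⟩ := Ideal.Quotient.mk_surjective y
    induction y using MvPolynomial.induction_on with
    | C a => exact isIntegral_algebraMap (R := F) (A := MvPolynomial σ F ⧸ I) (x := a)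
    | add p q hp hq => rw [map_add]; exact hp.add hq
    | mul_X p s hp =>
      rw [map_mul]
      refine hp.mul ?_
      obtain ⟨k, hk⟩ := h s
      apply IsIntegral.of_pow (n := k + 1) (Nat.succ_pos k)
      rw [← map_pow, Ideal.Quotient.eq_zero_iff_mem.2 (by rw [pow_succ]; exact I.mul_mem_right _ hk)]
      exact isIntegral_zero
  have : Module.Finite F (MvPolynomial σ F ⧸ I) := Algebra.IsIntegral.finite
  exact IsArtinianRing.of_finite F _

end Homogeneous

/-! ### The socle of a split complete intersection -/

section Socle

variable {F : Type*} [Field F] {σ : Type*}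

theorem mem_socle_mk_iff {I : Ideal (MvPolynomial σ F)} {h : MvPolynomial σ F} :
    Ideal.Quotient.mk I h ∈ socle I ↔ ∀ q, X q * h ∈ I := by
  constructor
  · intro hh q
    rw [← Ideal.Quotient.eq_zero_iff_mem, map_mul]
    exact hh _ (Ideal.subset_span ⟨q, rfl⟩)
  · intro hh m hm
    induction hm using Submodule.span_induction with
    | mem x hx =>
      obtain ⟨q, rfl⟩ := hx
      rw [← map_mul]
      exact Ideal.Quotient.eq_zero_iff_mem.2 (hh q)
    | zero => exact zero_mul _
    | add x y _ _ hx hy => rw [add_mul, hx, hy, add_zero]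
    | smul a x _ hx => rw [smul_eq_mul, mul_assoc, hx, mul_zero]

theorem IsSocleGenerator.smul {I : Ideal (MvPolynomial σ F)} {s : MvPolynomial σ F ⧸ I}
    (hs : IsSocleGenerator s) {c : F} (hc : c ≠ 0) : IsSocleGenerator (c • s) :=
  ⟨smul_ne_zero hc hs.1, by rw [hs.2, Submodule.span_singleton_smul_eq hc.isUnit]⟩

theorem IsSocleGenerator.exists_smul_eq {I : Ideal (MvPolynomial σ F)}
    {s t : MvPolynomial σ F ⧸ I} (hs : IsSocleGenerator s) (ht : IsSocleGenerator t) :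
    ∃ c : F, c ≠ 0 ∧ t = c • s := by
  have h : t ∈ Submodule.span F {s} := by
    rw [← hs.2, ht.2]; exact Submodule.mem_span_singleton_self t
  obtain ⟨c, rfl⟩ := Submodule.mem_span_singleton.1 h
  exact ⟨c, fun h0 => ht.1 (by rw [h0, zero_smul]), rfl⟩

/-- The relations `X p * g p`, with those for `p ∈ T` replaced by `X p`. -/
noncomputable def partialForm [DecidableEq σ] (g : σ → MvPolynomial σ F) (T : Finset σ) (p : σ) :
    MvPolynomial σ F :=
  if p ∈ T then X p else X p * g p

variable [DecidableEq σ] {g : σ → MvPolynomial σ F}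

theorem partialForm_empty : partialForm g ∅ = fun p => X p * g p := by
  funext p; simp [partialForm]

theorem span_partialForm_univ [Fintype σ] :
    Ideal.span (Set.range (partialForm g Finset.univ)) = idealOfVars σ F := by
  congr 2; funext p; simp [partialForm]

theorem span_partialForm_of_notMem {T : Finset σ} {p : σ} (hp : p ∉ T) :
    Ideal.span (Set.range (partialForm g T)) =
      Ideal.span {X p * g p} ⊔ Ideal.span (partialForm g T '' {p}ᶜ) := by
  rw [← Set.image_univ, span_image_eq_of_mem _ (Set.mem_univ p), Set.compl_eq_univ_sdiff]
  simp [partialForm, hp]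

theorem span_partialForm_insert {T : Finset σ} {p : σ} :
    Ideal.span (Set.range (partialForm g (insert p T))) =
      Ideal.span {X p} ⊔ Ideal.span (partialForm g T '' {p}ᶜ) := by
  rw [← Set.image_univ, span_image_eq_of_mem _ (Set.mem_univ p), Set.compl_eq_univ_sdiff]
  congr 2
  · simp [partialForm]
  · apply Set.image_congr
    rintro q ⟨-, hq⟩
    simp [partialForm, show q ≠ p from hq]

/-- `g` cuts out a split complete intersection: whenever each relation `X p * g p` is kept or
replaced by one of its factors `X p` and `g p`, the result is a regular family. -/
def IsSplitRegular (g : σ → MvPolynomial σ F) : Prop :=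
  ∀ f : σ → MvPolynomial σ F, (∀ p, f p = X p ∨ f p = g p ∨ f p = X p * g p) → IsRegularFamily f

theorem IsSplitRegular.regularMod (hg : IsSplitRegular g) (T : Finset σ) (p : σ)
    {b : MvPolynomial σ F} (hb : b = X p ∨ b = g p) :
    RegularMod (Ideal.span (partialForm g T '' {p}ᶜ)) b := by
  have h := hg (Function.update (partialForm g T) p b) (fun q => by
    by_cases hq : q = p
    · subst hq; rw [Function.update_self]; tauto
    · rw [Function.update_of_ne hq, partialForm]; split_ifs <;> simp) {p}ᶜ p (by simp)
  rwa [Function.update_self, span_image_update_of_notMem _ (by simp)] at h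

/-- Multiplication by `g p` embeds the quotient in which `X p * g p` is replaced by `X p`. -/
theorem IsSplitRegular.mul_mem_iff (hg : IsSplitRegular g) {T : Finset σ} {p : σ} (hp : p ∉ T)
    (u : MvPolynomial σ F) :
    g p * u ∈ Ideal.span (Set.range (partialForm g T)) ↔
      u ∈ Ideal.span (Set.range (partialForm g (insert p T))) := by
  rw [span_partialForm_of_notMem hp, span_partialForm_insert, Ideal.mem_span_singleton_sup,
    Ideal.mem_span_singleton_sup]
  constructor
  · rintro ⟨v, k, hk, hv⟩
    refine ⟨v, u - v * X p, hg.regularMod T p (Or.inr rfl) _ ?_, by ring⟩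
    rwa [show g p * (u - v * X p) = k by linear_combination -hv]
  · rintro ⟨v, k, hk, rfl⟩
    exact ⟨v, g p * k, Ideal.mul_mem_left _ _ hk, by ring⟩

theorem IsSplitRegular.prod_mul_mem_iff (hg : IsSplitRegular g) (T : Finset σ)
    (u : MvPolynomial σ F) :
    (∏ p ∈ T, g p) * u ∈ Ideal.span (Set.range (partialForm g ∅)) ↔
      u ∈ Ideal.span (Set.range (partialForm g T)) := by
  induction T using Finset.induction_on generalizing u with
  | empty => simp
  | insert p T hp ih =>
    rw [Finset.prod_insert hp, mul_comm (g p), mul_assoc, ih, hg.mul_mem_iff hp]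

/-- An element killed by all variables is a multiple of `∏ p ∈ T, g p`, one factor at a time:
the annihilator of `X p` modulo `X p * g p` is generated by `g p`. -/
theorem IsSplitRegular.exists_sub_prod_mul_mem (hg : IsSplitRegular g) (T : Finset σ)
    {h : MvPolynomial σ F} (hh : ∀ q, X q * h ∈ Ideal.span (Set.range (partialForm g ∅))) :
    ∃ u, h - (∏ p ∈ T, g p) * u ∈ Ideal.span (Set.range (partialForm g ∅)) := by
  induction T using Finset.induction_on with
  | empty => exact ⟨h, by simp⟩
  | insert p T hp ih =>
    obtain ⟨u, hu⟩ := ih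
    have h1 : X p * u ∈ Ideal.span (Set.range (partialForm g T)) := by
      rw [← hg.prod_mul_mem_iff]
      have := Ideal.sub_mem _ (hh p) (Ideal.mul_mem_left _ (X p) hu)
      rwa [show X p * h - X p * (h - (∏ p ∈ T, g p) * u) = (∏ p ∈ T, g p) * (X p * u) by ring]
        at this
    rw [span_partialForm_of_notMem hp, Ideal.mem_span_singleton_sup] at h1
    obtain ⟨v, k, hk, hv⟩ := h1
    have h2 : u - g p * v ∈ Ideal.span (partialForm g T '' {p}ᶜ) := by
      apply hg.regularMod T p (Or.inl rfl)
      rwa [show X p * (u - g p * v) = k by linear_combination -hv]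
    refine ⟨v, ?_⟩
    have h3 := (hg.prod_mul_mem_iff T (u - g p * v)).2 (by
      rw [span_partialForm_of_notMem hp]; exact Ideal.mem_sup_right h2)
    rw [Finset.prod_insert hp]
    have := Ideal.add_mem _ hu h3
    rwa [show h - (∏ p ∈ T, g p) * u + (∏ p ∈ T, g p) * (u - g p * v) =
      h - g p * (∏ p ∈ T, g p) * v by ring] at this

variable [Fintype σ]

theorem IsSplitRegular.exists_sub_C_mul_mem (hg : IsSplitRegular g) {h : MvPolynomial σ F}
    (hh : ∀ q, X q * h ∈ Ideal.span (Set.range fun p => X p * g p)) :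
    ∃ c : F, h - C c * ∏ p, g p ∈ Ideal.span (Set.range fun p => X p * g p) := by
  rw [← partialForm_empty] at hh ⊢
  obtain ⟨u, hu⟩ := hg.exists_sub_prod_mul_mem Finset.univ hh
  have h1 : u - C (coeff 0 u) ∈ idealOfVars σ F := by
    rw [← pow_one (idealOfVars σ F), mem_pow_idealOfVars_iff']
    intro x hx
    obtain rfl : x = 0 := by rw [← Finsupp.degree_eq_zero_iff]; omega
    simp
  rw [← span_partialForm_univ (g := g), ← hg.prod_mul_mem_iff] at h1
  refine ⟨coeff 0 u, ?_⟩
  have := Ideal.add_mem _ hu h1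
  rwa [show h - (∏ p, g p) * u + (∏ p, g p) * (u - C (coeff 0 u)) =
    h - C (coeff 0 u) * ∏ p, g p by ring] at this

theorem IsSplitRegular.isSocleGenerator (hg : IsSplitRegular g) :
    IsSocleGenerator (Ideal.Quotient.mk (Ideal.span (Set.range fun p => X p * g p)) (∏ p, g p)) := by
  refine ⟨?_, le_antisymm ?_ ?_⟩
  · intro h0
    have h1 := (hg.prod_mul_mem_iff Finset.univ 1).1 (by
      rw [mul_one, partialForm_empty]; exact Ideal.Quotient.eq_zero_iff_mem.1 h0)
    rw [span_partialForm_univ, ← pow_one (idealOfVars σ F), ← C_1, C_mem_pow_idealOfVars_iff] at h1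
    simp at h1
  · intro y hy
    obtain ⟨h, rfl⟩ := Ideal.Quotient.mk_surjective y
    obtain ⟨c, hc⟩ := hg.exists_sub_C_mul_mem (mem_socle_mk_iff.1 hy)
    rw [Submodule.mem_span_singleton]
    refine ⟨c, ?_⟩
    rw [Ideal.Quotient.mk_eq_mk_iff_sub_mem _ _ |>.2 hc, ← smul_eq_C_mul]
    rfl
  · rw [Submodule.span_singleton_le_iff_mem, mem_socle_mk_iff]
    intro q
    rw [mul_comm, ← partialForm_empty, hg.prod_mul_mem_iff, span_partialForm_univ]
    exact Ideal.subset_span ⟨q, rfl⟩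

/-- The socle degree is the top degree: a nonzero form of maximal degree lies in the socle. -/
theorem IsSplitRegular.mem_of_lt_degree (hg : IsSplitRegular g) {d : σ → ℕ}
    (hd : ∀ p, (g p).IsHomogeneous (d p))
    (hrad : ∀ p, X p ∈ (Ideal.span (Set.range fun p => X p * g p)).radical)
    {e : ℕ} (he : ∑ p, d p < e) {y : MvPolynomial σ F} (hy : y.IsHomogeneous e) :
    y ∈ Ideal.span (Set.range fun p => X p * g p) := by
  obtain ⟨K, hK⟩ := Ideal.exists_pow_le_of_le_radical_of_fg
    (show idealOfVars σ F ≤ (Ideal.span (Set.range fun p => X p * g p)).radical by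
      rw [Ideal.span_le]; rintro _ ⟨p, rfl⟩; exact hrad p) (idealOfVars_fg σ F)
  obtain ⟨m, hm⟩ : ∃ m, K ≤ e + m := ⟨K, by omega⟩
  induction m generalizing e y with
  | zero =>
    refine hK ((mem_pow_idealOfVars_iff' _ _).2 fun x hx => ?_)
    by_contra hne
    have hxe : x.degree = e := by
      rw [Finsupp.degree_eq_weight_one]
      exact hy hne
    omega
  | succ m ih =>
    obtain ⟨c, hc⟩ := hg.exists_sub_C_mul_mem (h := y) fun q =>
      ih (e := e + 1) (by omega) (by rw [add_comm]; exact (isHomogeneous_X F q).mul hy) (by omega)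
    have h1 := homogeneousComponent_mem_span_range
      (fun p => ⟨1 + d p, (isHomogeneous_X F p).mul (hd p)⟩) hc e
    rwa [map_sub, homogeneousComponent_eq_self hy, homogeneousComponent_C_mul,
      homogeneousComponent_of_mem (IsHomogeneous.prod _ _ _ fun p _ => hd p), if_neg (by omega),
      mul_zero, sub_zero] at h1

/-- Regularity in every order of a family of quadrics `X p * g p`. -/
theorem IsSplitRegular.isQuadraticCompleteIntersection (hg : IsSplitRegular g)
    (hd : ∀ p, (g p).IsHomogeneous 1) :
    IsQuadraticCompleteIntersection fun p => X p * g p := by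
  have hd2 : ∀ p, (X p * g p).IsHomogeneous 2 := fun p => (isHomogeneous_X F p).mul (hd p)
  refine ⟨hd2, fun l hl hmem => ⟨?_, ?_, ⟨⟨?_⟩, ?_⟩⟩⟩
  · rw [List.length_map, ← List.toFinset_card_of_nodup hl, Finset.card_eq_iff_eq_univ]
    ext p; simp [hmem]
  · intro f hf
    obtain ⟨p, -, rfl⟩ := List.mem_map.1 hf
    exact ⟨2, two_pos, hd2 p⟩
  · intro i hi
    rw [isSMulRegular_quotient_iff_mem_of_smul_mem]
    rw [List.length_map] at hi
    have hlist : (Ideal.ofList ((l.map fun p => X p * g p).take i) • ⊤ : Ideal (MvPolynomial σ F)) =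
        Ideal.span ((fun p => X p * g p) '' {p | p ∈ l.take i}) := by
      rw [smul_eq_mul, Ideal.mul_top, Ideal.ofList, ← List.map_take]
      congr 1
      ext y
      exact List.mem_map
    intro x hx
    rw [hlist] at hx ⊢
    refine hg _ (fun p => Or.inr (Or.inr rfl)) _ l[i] ?_ x (by simpa using hx)
    intro hmem
    obtain ⟨j, hj, hji⟩ := List.mem_take_iff_getElem.1 hmem
    have := (hl.getElem_inj_iff (hi := by omega) (hj := hi)).1 hji
    omega
  · intro h
    have h1 : (1 : MvPolynomial σ F) ∈ idealOfVars σ F := by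
      have h2 : (Ideal.ofList (l.map fun p => X p * g p)) ≤ idealOfVars σ F := by
        rw [Ideal.ofList, Ideal.span_le]
        intro y hy
        obtain ⟨p, -, rfl⟩ := List.mem_map.1 hy
        exact Ideal.mul_mem_right _ _ (Ideal.subset_span ⟨p, rfl⟩)
      apply h2
      rw [smul_eq_mul, Ideal.mul_top] at h
      rw [← h]; trivial
    rw [← pow_one (idealOfVars σ F), ← C_1, C_mem_pow_idealOfVars_iff] at h1
    simp at h1

end Socle

/-- The criterion for split regularity: each `g p` is a product of linear forms, and the common
zero locus of the `X p * g p` is the origin. -/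
theorem IsSplitRegular.of_mem_radical {F : Type*} [Field F] {σ : Type*} [Fintype σ]
    {g : σ → MvPolynomial σ F} (G : σ → Set (MvPolynomial σ F))
    (hlin : ∀ p, ∀ b ∈ G p, b ∈ Submodule.span F (Set.range (X : σ → MvPolynomial σ F)))
    (hg : ∀ p, g p ∈ Submonoid.closure (G p)) (hdvd : ∀ p, ∀ b ∈ G p, b ∣ g p)
    (hrad : ∀ p, X p ∈ (Ideal.span (Set.range fun p => X p * g p)).radical) :
    IsSplitRegular g := by
  intro f hf
  have hX : ∀ p, X p ∈ Submonoid.closure (insert (X p) (G p)) := fun p =>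
    Submonoid.subset_closure (Set.mem_insert _ _)
  have hg' : ∀ p, g p ∈ Submonoid.closure (insert (X p) (G p)) := fun p =>
    Submonoid.closure_mono (Set.subset_insert _ _) (hg p)
  refine IsRegularFamily.of_closure (G := fun p => insert (X p) (G p))
    (fun p => ⟨X p, Set.mem_insert _ _⟩) (fun χ hχ => ?_) f fun p => ?_
  · refine isRegularFamily_of_linear χ (fun p => ?_) fun p => Ideal.radical_mono ?_ (hrad p)
    · rcases hχ p with h | h
      · rw [h]; exact Submodule.subset_span ⟨p, rfl⟩
      · exact hlin p _ h
    · rw [Ideal.span_le]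
      rintro _ ⟨q, rfl⟩
      have h1 : χ q ∣ X q * g q := by
        rcases hχ q with h | h
        · rw [h]; exact dvd_mul_right _ _
        · exact (hdvd q _ h).mul_left _
      exact Ideal.mem_of_dvd _ h1 (Ideal.subset_span ⟨q, rfl⟩)
  · rcases hf p with h | h | h
    · rw [h]; exact hX p
    · rw [h]; exact hg' p
    · rw [h]; exact Submonoid.mul_mem _ (hX p) (hg' p)

/-! ### Splitting a relation into quadratic ones -/

section Chain

universe u

/-- Adjoining a root `t` of a monic polynomial `P` subject to `x * (w - t) = 0` imposes no
condition on the base ring beyond `x * P(w) = 0`. Indeed, if a constant `h` is a combination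
`P * c + x * (w - T) * u`, then `P * c` is constant modulo `x`, so `x` divides `c`; now put
`T = w`. -/
theorem exists_adjoin_root {D : Type u} [CommRing D] (x w : D) {P : Polynomial D} (hP : P.Monic)
    (hdeg : 0 < P.natDegree) (h : x * P.eval w = 0) :
    ∃ (E : Type u) (_ : CommRing E) (ι : D →+* E) (t : E), Function.Injective ι ∧
      (P.map ι).eval t = 0 ∧ ι x * (ι w - t) = 0 := by
  let J : Ideal (Polynomial D) :=
    Ideal.span {P, Polynomial.C x * (Polynomial.C w - Polynomial.X)}
  refine ⟨Polynomial D ⧸ J, inferInstance, (Ideal.Quotient.mk J).comp Polynomial.C,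
    Ideal.Quotient.mk J Polynomial.X, ?_, ?_, ?_⟩
  · rw [injective_iff_map_eq_zero]
    intro y hy
    obtain ⟨c, u, hcu⟩ := Ideal.mem_span_pair.1 (Ideal.Quotient.eq_zero_iff_mem.1 hy)
    let π := Ideal.Quotient.mk (Ideal.span {x})
    have hx : π x = 0 := Ideal.Quotient.eq_zero_iff_mem.2 (Ideal.mem_span_singleton_self x)
    have hc : c.map π = 0 := by
      by_contra hne
      have : Nontrivial (D ⧸ Ideal.span {x}) := by
        by_contra htriv
        rw [not_nontrivial_iff_subsingleton] at htriv
        exact hne (Subsingleton.elim _ _)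
      have h1 := congrArg (Polynomial.map π) hcu
      simp only [Polynomial.map_add, Polynomial.map_mul, Polynomial.map_C, hx, map_zero, zero_mul,
        mul_zero, add_zero] at h1
      have h2 := congrArg Polynomial.natDegree h1
      rw [mul_comm, (hP.map π).natDegree_mul' hne, hP.natDegree_map, Polynomial.natDegree_C] at h2
      omega
    have hcx : ∃ b, c = Polynomial.C x * b := by
      rw [← dvd_iff_exists_eq_mul_right, Polynomial.C_dvd_iff_dvd_coeff]
      intro i
      have := congrArg (fun q => Polynomial.coeff q i) hc
      simpa [π, Ideal.Quotient.eq_zero_iff_mem, Ideal.mem_span_singleton] using this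
    obtain ⟨b, rfl⟩ := hcx
    have h3 := congrArg (Polynomial.eval w) hcu
    simp only [Polynomial.eval_add, Polynomial.eval_mul, Polynomial.eval_C, Polynomial.eval_sub,
      Polynomial.eval_X, sub_self, mul_zero, add_zero] at h3
    rw [← h3]
    linear_combination (Polynomial.eval w b) * h
  · rw [Polynomial.eval_map, ← Polynomial.hom_eval₂, Polynomial.eval₂_C_X]
    exact Ideal.Quotient.eq_zero_iff_mem.2 (Ideal.subset_span (by simp))
  · rw [RingHom.comp_apply, RingHom.comp_apply, ← map_sub, ← map_mul]
    exact Ideal.Quotient.eq_zero_iff_mem.2 (Ideal.subset_span (by simp))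

/-- The monic polynomial `T * ∏_{k < m} (T - a_k)`. -/
noncomputable def chainPoly {D : Type*} [CommRing D] (a : ℕ → D) (m : ℕ) : Polynomial D :=
  Polynomial.X * ∏ k ∈ Finset.range m, (Polynomial.X - Polynomial.C (a k))

variable {D : Type*} [CommRing D] (a : ℕ → D) (m : ℕ)

theorem chainPoly_succ :
    chainPoly a (m + 1) = chainPoly a m * (Polynomial.X - Polynomial.C (a m)) := by
  rw [chainPoly, Finset.prod_range_succ, ← mul_assoc, chainPoly]

theorem eval_chainPoly (t : D) :
    (chainPoly a m).eval t = t * ∏ k ∈ Finset.range m, (t - a k) := by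
  simp [chainPoly, Polynomial.eval_prod]

theorem map_chainPoly {E : Type*} [CommRing E] (f : D →+* E) :
    (chainPoly a m).map f = chainPoly (fun k => f (a k)) m := by
  simp [chainPoly, Polynomial.map_prod]

theorem monic_chainPoly : (chainPoly a m).Monic :=
  Polynomial.monic_X.mul (Polynomial.monic_prod_of_monic _ _ fun _ _ => Polynomial.monic_X_sub_C _)

theorem natDegree_chainPoly_pos [Nontrivial D] : 0 < (chainPoly a m).natDegree := by
  rw [chainPoly, Polynomial.monic_X.natDegree_mul
    (Polynomial.monic_prod_of_monic _ _ fun _ _ => Polynomial.monic_X_sub_C _),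
    Polynomial.natDegree_X]
  omega

/-- `S 0, …, S m` is a chain of partial sums that satisfies the quadratic relations of one block:
`S 0 = 0`, the increment of each step annihilates `S (k + 1) - a k`, and `x` annihilates
`w - S m`. -/
structure IsChain (x w : D) (a : ℕ → D) (m : ℕ) (S : ℕ → D) : Prop where
  zero : S 0 = 0
  step : ∀ k < m, (S (k + 1) - S k) * (S (k + 1) - a k) = 0
  last : x * (w - S m) = 0

variable {a m}

theorem IsChain.map {x w : D} {S : ℕ → D} (h : IsChain x w a m S) {E : Type*} [CommRing E]
    (f : D →+* E) : IsChain (f x) (f w) (fun k => f (a k)) m (fun k => f (S k)) where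
  zero := by rw [h.zero, map_zero]
  step k hk := by rw [← map_sub, ← map_sub, ← map_mul, h.step k hk, map_zero]
  last := by rw [← map_sub, ← map_mul, h.last, map_zero]

/-- The quadratic relations imply the relation of higher degree: since `u - v` divides
`P(u) - P(v)`, the relations allow to replace `w` by `S m`, then `S m` by `S (m - 1)`, and so on
down to `S 0 = 0`. -/
theorem IsChain.mul_eval_eq_zero {x w : D} {S : ℕ → D} (h : IsChain x w a m S) :
    x * (chainPoly a m).eval w = 0 := by
  have hS : ∀ k ≤ m, (chainPoly a k).eval (S k) = 0 := by
    intro k hk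
    induction k with
    | zero => simp [chainPoly, h.zero]
    | succ k ih =>
      obtain ⟨c, hc⟩ := Polynomial.sub_dvd_eval_sub (S (k + 1)) (S k) (chainPoly a k)
      rw [ih (by omega), sub_zero] at hc
      rw [chainPoly_succ, Polynomial.eval_mul, hc, Polynomial.eval_sub, Polynomial.eval_X,
        Polynomial.eval_C]
      linear_combination c * h.step k hk
  obtain ⟨c, hc⟩ := Polynomial.sub_dvd_eval_sub w (S m) (chainPoly a m)
  rw [hS m le_rfl, sub_zero] at hc
  rw [hc]
  linear_combination c * h.last

/-- Conversely, if `x * P(w) = 0` then a chain exists in an extension ring: adjoin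
`S m, S (m - 1), …, S 1` one after the other. -/
theorem exists_isChain {D : Type u} [CommRing D] (x w : D) (a : ℕ → D) (m : ℕ)
    (h : x * (chainPoly a m).eval w = 0) :
    ∃ (E : Type u) (_ : CommRing E) (ι : D →+* E) (S : ℕ → E), Function.Injective ι ∧
      IsChain (ι x) (ι w) (fun k => ι (a k)) m S := by
  induction m generalizing D with
  | zero =>
    refine ⟨D, inferInstance, RingHom.id D, fun _ => 0, Function.injective_id, rfl, by simp, ?_⟩
    simpa [chainPoly] using h
  | succ m ih =>
    rcases subsingleton_or_nontrivial D with hD | hD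
    · exact ⟨D, inferInstance, RingHom.id D, fun _ => 0, Function.injective_id, rfl,
        fun _ _ => Subsingleton.elim _ _, Subsingleton.elim _ _⟩
    obtain ⟨E, _, ι, t, hι, ht, hxt⟩ :=
      exists_adjoin_root x w (monic_chainPoly a (m + 1)) (natDegree_chainPoly_pos a (m + 1)) h
    rw [map_chainPoly, chainPoly_succ, Polynomial.eval_mul, Polynomial.eval_sub, Polynomial.eval_X,
      Polynomial.eval_C, mul_comm] at ht
    obtain ⟨E', _, ι', S, hι', hS⟩ := ih (t - ι (a m)) t (fun k => ι (a k)) ht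
    refine ⟨E', inferInstance, ι'.comp ι, fun k => if k ≤ m then S k else ι' t, hι'.comp hι,
      ?_, ?_, ?_⟩
    · simpa using hS.zero
    · intro k hk
      rcases Nat.lt_or_ge k m with hkm | hkm
      · simpa [hkm.le, Nat.succ_le_of_lt hkm] using hS.step k hkm
      · obtain rfl : k = m := by omega
        have := hS.last
        simp only [le_refl, if_true, Nat.not_succ_le_self, if_false, RingHom.comp_apply]
        rw [← map_sub, mul_comm]
        exact this
    · have := congrArg ι' hxt
      simpa using this

theorem exists_isChain_family {J : Type*} [Finite J] {D : Type u} [CommRing D] (x w : J → D)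
    (a : J → ℕ → D) (m : J → ℕ) (h : ∀ i, x i * (chainPoly (a i) (m i)).eval (w i) = 0) :
    ∃ (E : Type u) (_ : CommRing E) (ι : D →+* E) (S : J → ℕ → E), Function.Injective ι ∧
      ∀ i, IsChain (ι (x i)) (ι (w i)) (fun k => ι (a i k)) (m i) (S i) := by
  classical
  cases nonempty_fintype J
  suffices H : ∀ U : Finset J, ∃ (E : Type u) (_ : CommRing E) (ι : D →+* E) (S : J → ℕ → E),
      Function.Injective ι ∧
      ∀ i ∈ U, IsChain (ι (x i)) (ι (w i)) (fun k => ι (a i k)) (m i) (S i) by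
    simpa using H Finset.univ
  intro U
  induction U using Finset.induction_on with
  | empty => exact ⟨D, inferInstance, RingHom.id D, fun _ _ => 0, Function.injective_id, by simp⟩
  | insert i U hi ih =>
    obtain ⟨E, _, ι, S, hι, hS⟩ := ih
    obtain ⟨E', _, ι', S', hι', hS'⟩ := exists_isChain (ι (x i)) (ι (w i)) (fun k => ι (a i k)) (m i)
      (by
        have := congrArg ι (h i)
        rwa [map_mul, map_zero, ← Polynomial.eval_map_apply, map_chainPoly] at this)
    refine ⟨E', inferInstance, ι'.comp ι, fun j => if j = i then S' else fun k => ι' (S j k),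
      hι'.comp hι, fun j hj => ?_⟩
    by_cases hji : j = i
    · subst hji; simpa using hS'
    · simp only [if_neg hji]
      exact (hS j ((Finset.mem_insert.1 hj).resolve_left hji)).map ι'

end Chain

/-! ### The quadratic relations of one block -/

section Blocks

variable {F : Type*} [Field F] {n : ℕ} (N : Fin n → ℕ) (hN : ∀ i, 0 < N i)
  (lam : Fin n → ℕ → Fin n → F)

/-- The linear form `x_i - ∑_{j ≠ i} λ_{i,j}^0 x_j`. -/
noncomputable def baseForm (i : Fin n) : MvPolynomial (Fin n) F :=
  X i - ∑ j ∈ Finset.univ.erase i, C (lam i 0 j) * X j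

/-- The linear form `∑_{j ≠ i} (λ_{i,j}^{N_i-1-k} - λ_{i,j}^0) x_j`; `baseForm i` minus it is the
factor of `splitForm i` of index `N_i - 1 - k`. -/
noncomputable def shiftForm (i : Fin n) (k : ℕ) : MvPolynomial (Fin n) F :=
  ∑ j ∈ Finset.univ.erase i, C (lam i (N i - (k + 1)) j - lam i 0 j) * X j

/-- The cofactor of `X i` in `splitForm i`. -/
noncomputable def splitCofactor (i : Fin n) : MvPolynomial (Fin n) F :=
  ∏ k ∈ Finset.range (N i), (X i - ∑ j ∈ Finset.univ.erase i, C (lam i k j) * X j)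

/-- The partial sum `Z_{i,1} + ⋯ + Z_{i,k}`. -/
noncomputable def blockSum (F : Type*) [Field F] (i : Fin n) (k : ℕ) : MvPolynomial (ZIndex N) F :=
  ∑ m ∈ Finset.univ.filter (fun m : Fin (N i) => (m : ℕ) < k), X ⟨i, m⟩

/-- The substitution `x_i ↦ Z_{i,N_i}`. -/
noncomputable def lastRename (F : Type*) [Field F] :
    MvPolynomial (Fin n) F →ₐ[F] MvPolynomial (ZIndex N) F :=
  rename (lastIndex N hN)

variable {N lam}

theorem blockSum_zero (i : Fin n) : blockSum N F i 0 = 0 := by simp [blockSum]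

theorem blockSum_succ (i : Fin n) (m : Fin (N i)) :
    blockSum N F i (m + 1) = blockSum N F i m + X ⟨i, m⟩ := by
  rw [blockSum, blockSum, add_comm (Finset.sum _ _),
    ← Finset.sum_insert (f := fun k => (X ⟨i, k⟩ : MvPolynomial (ZIndex N) F)) (by simp)]
  congr 1
  ext k
  simp only [Finset.mem_filter, Finset.mem_univ, true_and, Finset.mem_insert, Fin.ext_iff]
  omega

theorem splitForm_eq : splitForm N lam = fun i => X i * splitCofactor N lam i := rfl

theorem lastRename_X (i : Fin n) : lastRename N hN F (X i) = X (lastIndex N hN i) := rename_X _ _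

theorem sum_Iio_X (i : Fin n) (m : Fin (N i)) :
    ∑ k ∈ Finset.Iio m, (X ⟨i, k⟩ : MvPolynomial (ZIndex N) F) = blockSum N F i m := by
  rw [blockSum]
  congr 1
  ext k
  rw [Finset.mem_Iio, Fin.lt_def, Finset.mem_filter]
  simp

theorem sum_Iic_X (i : Fin n) (m : Fin (N i)) :
    ∑ k ∈ Finset.Iic m, (X ⟨i, k⟩ : MvPolynomial (ZIndex N) F) = blockSum N F i (m + 1) := by
  rw [blockSum]
  congr 1
  ext k
  rw [Finset.mem_Iic, Fin.le_def, Finset.mem_filter, Nat.lt_succ_iff]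
  simp

theorem linForm_of_lt {p : ZIndex N} (hp : (p.2 : ℕ) + 1 < N p.1) :
    linForm N hN lam p =
      blockSum N F p.1 (p.2 + 1) - lastRename N hN F (shiftForm N lam p.1 p.2) := by
  rw [linForm, if_neg hp.ne, sum_Iic_X, shiftForm]
  congr 1
  simp only [lastRename, map_sum, map_mul, rename_X, rename_C]

theorem linForm_lastIndex (i : Fin n) :
    linForm N hN lam (lastIndex N hN i) =
      blockSum N F i (N i - 1) - lastRename N hN F (baseForm lam i) := by
  have := hN i
  rw [linForm, if_pos (by simp only [lastIndex]; omega), sum_Iio_X]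
  simp only [baseForm, lastRename, map_sub, map_sum, map_mul, rename_X, rename_C]
  simp only [lastIndex]
  ring

theorem eq_lastIndex_of_le {p : ZIndex N} (hp : ¬ (p.2 : ℕ) + 1 < N p.1) :
    p = lastIndex N hN p.1 := by
  obtain ⟨i, m, hm⟩ := p
  simp only [lastIndex, Sigma.mk.injEq, heq_eq_eq, Fin.mk.injEq, true_and] at hp ⊢
  omega

/-- The factor with `k = 0` is `baseForm i`; the others are `baseForm i - shiftForm i k`. -/
theorem splitCofactor_eq (i : Fin n) (hi : 0 < N i) :
    splitCofactor N lam i =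
      (chainPoly (shiftForm N lam i) (N i - 1)).eval (baseForm lam i) := by
  obtain ⟨m, hm⟩ : ∃ m, N i = m + 1 := ⟨N i - 1, by omega⟩
  rw [eval_chainPoly, splitCofactor, hm, Finset.prod_range_succ', mul_comm,
    ← Finset.prod_range_reflect, Nat.add_sub_cancel]
  congr 1
  refine Finset.prod_congr rfl fun k hk => ?_
  have hk' := Finset.mem_range.1 hk
  rw [shiftForm, baseForm, hm, show m - 1 - k + 1 = m + 1 - (k + 1) by omega, sub_sub,
    ← Finset.sum_add_distrib]
  congr 1
  refine Finset.sum_congr rfl fun j _ => ?_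
  rw [← add_mul, ← C_add, add_sub_cancel]

/-- A ring homomorphism kills the quadratic relations if it maps the partial sums to chains. -/
theorem quadIdeal_le_ker_iff {E : Type*} [CommRing E] (ψ : MvPolynomial (ZIndex N) F →+* E) :
    quadIdeal N hN lam ≤ RingHom.ker ψ ↔
      ∀ i, IsChain (ψ (lastRename N hN F (X i))) (ψ (lastRename N hN F (baseForm lam i)))
        (fun k => ψ (lastRename N hN F (shiftForm N lam i k))) (N i - 1)
        (fun k => ψ (blockSum N F i k)) := by
  have hlast : ∀ i, ψ (quadForm N hN lam (lastIndex N hN i)) =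
      ψ (lastRename N hN F (X i)) * (ψ (blockSum N F i (N i - 1)) -
        ψ (lastRename N hN F (baseForm lam i))) := fun i => by
    rw [quadForm, linForm_lastIndex, lastRename_X, map_mul, map_sub]
  have hlt : ∀ i, ∀ m : Fin (N i), (m : ℕ) + 1 < N i → ψ (quadForm N hN lam ⟨i, m⟩) =
      (ψ (blockSum N F i (m + 1)) - ψ (blockSum N F i m)) * (ψ (blockSum N F i (m + 1)) -
        ψ (lastRename N hN F (shiftForm N lam i m))) := fun i m hm => by
    rw [quadForm, linForm_of_lt hN hm, map_mul, map_sub, ← map_sub ψ _ (blockSum N F i m),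
      blockSum_succ, add_sub_cancel_left]
  rw [quadIdeal, Ideal.span_le]
  constructor
  · intro h i
    refine ⟨by rw [blockSum_zero, map_zero], fun k hk => ?_, ?_⟩
    · rw [← hlt i ⟨k, by omega⟩ (by simp only; omega)]
      exact h ⟨_, rfl⟩
    · rw [← neg_eq_zero, ← mul_neg, neg_sub, ← hlast i]
      exact h ⟨_, rfl⟩
  · rintro h _ ⟨p, rfl⟩
    by_cases hp : (p.2 : ℕ) + 1 < N p.1
    · exact (hlt p.1 p.2 hp).trans ((h p.1).step p.2 (by omega))
    · rw [eq_lastIndex_of_le hN hp]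
      refine (hlast p.1).trans ?_
      rw [← neg_eq_zero, ← mul_neg, neg_sub]
      exact (h p.1).last

theorem lastRename_mem_quadIdeal {y : MvPolynomial (Fin n) F} (hy : y ∈ splitIdeal N lam) :
    lastRename N hN F y ∈ quadIdeal N hN lam := by
  have h := (quadIdeal_le_ker_iff (lam := lam) hN (Ideal.Quotient.mk (quadIdeal N hN lam))).1
    (by rw [Ideal.mk_ker])
  suffices H : splitIdeal N lam ≤ (quadIdeal N hN lam).comap (lastRename N hN F).toRingHom from H hy
  rw [splitIdeal, Ideal.span_le]
  rintro _ ⟨i, rfl⟩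
  have h1 := (h i).mul_eval_eq_zero
  let f := (Ideal.Quotient.mk (quadIdeal N hN lam)).comp (lastRename N hN F).toRingHom
  have h2 : chainPoly (fun k => Ideal.Quotient.mk (quadIdeal N hN lam)
      (lastRename N hN F (shiftForm N lam i k))) (N i - 1) =
      (chainPoly (shiftForm N lam i) (N i - 1)).map f := (map_chainPoly _ _ f).symm
  rw [h2] at h1
  have h3 : f (splitForm N lam i) = 0 := by
    rw [splitForm_eq]
    simp only
    rw [map_mul, splitCofactor_eq i (hN i), ← Polynomial.eval_map_apply]
    exact h1
  exact (Ideal.Quotient.eq_zero_iff_mem (I := quadIdeal N hN lam)).1 h3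

/-- `A → Â` is injective: `A` embeds into a ring in which all blocks have chains, and the chains
define a homomorphism from `Â` to that ring. -/
theorem mem_splitIdeal_of_lastRename_mem {y : MvPolynomial (Fin n) F}
    (hy : lastRename N hN F y ∈ quadIdeal N hN lam) : y ∈ splitIdeal N lam := by
  let π := Ideal.Quotient.mk (splitIdeal N lam)
  obtain ⟨E, _, ι, S, hι, hS⟩ := exists_isChain_family (D := SplitAlgebra N lam)
    (fun i => π (X i)) (fun i => π (baseForm lam i)) (fun i k => π (shiftForm N lam i k))
    (fun i => N i - 1) (fun i => by
      rw [← map_chainPoly, Polynomial.eval_map_apply, ← splitCofactor_eq i (hN i), ← map_mul]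
      exact Ideal.Quotient.eq_zero_iff_mem.2 (Ideal.subset_span ⟨i, rfl⟩))
  let v : ZIndex N → E := fun p =>
    if (p.2 : ℕ) + 1 < N p.1 then S p.1 (p.2 + 1) - S p.1 p.2 else ι (π (X p.1))
  let ψ : MvPolynomial (ZIndex N) F →+* E := eval₂Hom ((ι.comp π).comp C) v
  have hren : ∀ y, ψ (lastRename N hN F y) = ι (π y) := by
    have : ψ.comp (lastRename N hN F).toRingHom = ι.comp π := by
      apply ringHom_ext
      · intro r
        simp [ψ, lastRename]
      · intro i
        have := hN i
        simp only [ψ, lastRename, v, lastIndex, RingHom.comp_apply, AlgHom.toRingHom_eq_coe,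
          RingHom.coe_coe, rename_X, coe_eval₂Hom, eval₂_X]
        rw [if_neg (by omega)]
    exact fun y => RingHom.congr_fun this y
  have hsum : ∀ i, ∀ k < N i, ψ (blockSum N F i k) = S i k := by
    intro i k hk
    induction k with
    | zero => rw [blockSum_zero, map_zero, (hS i).zero]
    | succ k ih =>
      rw [blockSum_succ i ⟨k, by omega⟩, map_add, ih (by omega)]
      simp [ψ, v, hk]
  have hker : quadIdeal N hN lam ≤ RingHom.ker ψ := by
    rw [quadIdeal_le_ker_iff]
    intro i
    have := hN i
    simp only [hren]
    refine ⟨?_, fun k hk => ?_, ?_⟩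
    · rw [hsum i 0 this, (hS i).zero]
    · rw [hsum i k (by omega), hsum i (k + 1) (by omega)]
      exact (hS i).step k hk
    · rw [hsum i _ (by omega)]
      exact (hS i).last
  have h1 : ι (π y) = 0 := by rw [← hren]; exact hker hy
  exact Ideal.Quotient.eq_zero_iff_mem.1 ((map_eq_zero_iff ι hι).1 h1)

/-! ### The two algebras as split complete intersections -/

theorem X_sub_sum_mem_span_X (i : Fin n) (c : Fin n → F) :
    X i - ∑ j ∈ Finset.univ.erase i, C (c j) * X j ∈
      Submodule.span F (Set.range (X : Fin n → MvPolynomial (Fin n) F)) := by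
  refine Submodule.sub_mem _ (Submodule.subset_span ⟨i, rfl⟩) (Submodule.sum_mem _ fun j _ => ?_)
  rw [← smul_eq_C_mul]
  exact Submodule.smul_mem _ _ (Submodule.subset_span ⟨j, rfl⟩)

theorem isHomogeneous_one_of_mem_span_X {σ : Type*} {b : MvPolynomial σ F}
    (hb : b ∈ Submodule.span F (Set.range (X : σ → MvPolynomial σ F))) : b.IsHomogeneous 1 := by
  rw [← mem_homogeneousSubmodule]
  refine Submodule.span_le.2 ?_ hb
  rintro _ ⟨p, rfl⟩
  exact (mem_homogeneousSubmodule _ _).2 (isHomogeneous_X F p)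

theorem isHomogeneous_splitCofactor (i : Fin n) : (splitCofactor N lam i).IsHomogeneous (N i) := by
  have := IsHomogeneous.prod (Finset.range (N i))
    (fun k => X i - ∑ j ∈ Finset.univ.erase i, C (lam i k j) * X j) (fun _ => 1)
    fun k _ => isHomogeneous_one_of_mem_span_X (X_sub_sum_mem_span_X i (lam i k))
  rw [splitCofactor]
  simpa only [Finset.sum_const, Finset.card_range, smul_eq_mul, mul_one] using this

theorem linForm_mem_span_X (p : ZIndex N) :
    linForm N hN lam p ∈
      Submodule.span F (Set.range (X : ZIndex N → MvPolynomial (ZIndex N) F)) := by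
  have hX : ∀ q : ZIndex N, (X q : MvPolynomial (ZIndex N) F) ∈
      Submodule.span F (Set.range (X : ZIndex N → MvPolynomial (ZIndex N) F)) :=
    fun q => Submodule.subset_span ⟨q, rfl⟩
  have hC : ∀ (c : F) (q : ZIndex N), C c * (X q : MvPolynomial (ZIndex N) F) ∈
      Submodule.span F (Set.range (X : ZIndex N → MvPolynomial (ZIndex N) F)) := fun c q => by
    rw [← smul_eq_C_mul]
    exact Submodule.smul_mem _ _ (hX q)
  rw [linForm]
  split_ifs
  · exact Submodule.add_mem _ (Submodule.sub_mem _ (Submodule.sum_mem _ fun _ _ => hX _) (hX _))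
      (Submodule.sum_mem _ fun _ _ => hC _ _)
  · exact Submodule.sub_mem _ (Submodule.sum_mem _ fun _ _ => hX _)
      (Submodule.sum_mem _ fun _ _ => hC _ _)

theorem X_mem_radical_splitIdeal [IsArtinianRing (SplitAlgebra N lam)] (i : Fin n) :
    X i ∈ (splitIdeal N lam).radical :=
  have : IsArtinianRing (MvPolynomial (Fin n) F ⧸ Ideal.span (Set.range (splitForm N lam))) :=
    ‹IsArtinianRing (SplitAlgebra N lam)›
  X_mem_radical_of_isArtinianRing (f := splitForm N lam)
    (fun i => ⟨1 + N i, (isHomogeneous_X F i).mul (isHomogeneous_splitCofactor i)⟩) i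

/-- The variables `Z_{i,N_i}` are nilpotent because they come from `A`. Then so are
`Z_{i,1}, Z_{i,2}, …` in this order, as the square of `Z_{i,k}` is a combination of the previous
ones and the `Z_{j,N_j}`. -/
theorem X_mem_radical_quadIdeal [IsArtinianRing (SplitAlgebra N lam)] (p : ZIndex N) :
    X p ∈ (quadIdeal N hN lam).radical := by
  have hren : ∀ i, X (lastIndex N hN i) ∈ (quadIdeal N hN lam).radical := by
    intro i
    obtain ⟨k, hk⟩ := X_mem_radical_splitIdeal (N := N) (lam := lam) i
    refine ⟨k, ?_⟩
    rw [← lastRename_X, ← map_pow]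
    exact lastRename_mem_quadIdeal hN hk
  have hshift : ∀ i k, lastRename N hN F (shiftForm N lam i k) ∈ (quadIdeal N hN lam).radical := by
    intro i k
    rw [shiftForm, map_sum]
    refine Ideal.sum_mem _ fun j _ => ?_
    rw [map_mul, lastRename_X]
    exact Ideal.mul_mem_left _ _ (hren j)
  have hsum : ∀ i, ∀ k < N i, blockSum N F i k ∈ (quadIdeal N hN lam).radical ∧
      ∀ m : Fin (N i), (m : ℕ) < k → X ⟨i, m⟩ ∈ (quadIdeal N hN lam).radical := by
    intro i k hk
    induction k with
    | zero => exact ⟨by rw [blockSum_zero]; exact Ideal.zero_mem _, by simp⟩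
    | succ k ih =>
      obtain ⟨h1, h2⟩ := ih (by omega)
      have h3 : X ⟨i, ⟨k, by omega⟩⟩ ∈ (quadIdeal N hN lam).radical := by
        have h4 : quadForm N hN lam ⟨i, ⟨k, by omega⟩⟩ ∈ (quadIdeal N hN lam).radical :=
          Ideal.le_radical (Ideal.subset_span ⟨_, rfl⟩)
        rw [quadForm, linForm_of_lt hN (by simpa using hk), blockSum_succ] at h4
        have h5 := Ideal.mul_mem_left _ (X ⟨i, ⟨k, by omega⟩⟩) (Ideal.sub_mem _ h1 (hshift i k))
        have h6 := Ideal.sub_mem _ h4 h5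
        refine Ideal.radical_isRadical (quadIdeal N hN lam) ⟨2, ?_⟩
        convert h6 using 1
        ring
      refine ⟨?_, fun m hm => ?_⟩
      · rw [blockSum_succ i ⟨k, by omega⟩]
        exact Ideal.add_mem _ h1 h3
      · rcases Nat.lt_or_ge m k with hmk | hmk
        · exact h2 m hmk
        · rw [show m = ⟨k, by omega⟩ from Fin.ext (by simp only; omega)]
          exact h3
  by_cases hp : (p.2 : ℕ) + 1 < N p.1
  · exact (hsum p.1 _ hp).2 p.2 (Nat.lt_succ_self _)
  · rw [eq_lastIndex_of_le hN hp]
    exact hren _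

theorem isSplitRegular_splitCofactor [IsArtinianRing (SplitAlgebra N lam)] :
    IsSplitRegular (splitCofactor N lam) := by
  refine IsSplitRegular.of_mem_radical
    (fun i => (fun k => X i - ∑ j ∈ Finset.univ.erase i, C (lam i k j) * X j) ''
      (Finset.range (N i) : Set ℕ)) ?_ (fun i => ?_) ?_ X_mem_radical_splitIdeal
  · rintro i _ ⟨k, -, rfl⟩
    exact X_sub_sum_mem_span_X i (lam i k)
  · exact Submonoid.prod_mem _ fun k hk => Submonoid.subset_closure ⟨k, hk, rfl⟩
  · rintro i _ ⟨k, hk, rfl⟩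
    exact Finset.dvd_prod_of_mem _ hk

theorem isSplitRegular_linForm [IsArtinianRing (SplitAlgebra N lam)] :
    IsSplitRegular (linForm N hN lam) := by
  refine IsSplitRegular.of_mem_radical (fun p => {linForm N hN lam p}) ?_
    (fun p => Submonoid.subset_closure rfl) ?_ (X_mem_radical_quadIdeal hN)
  · rintro p _ rfl
    exact linForm_mem_span_X hN p
  · rintro p _ rfl
    exact dvd_rfl

end Blocks

end SplitCI

/-! ### The embedding -/

theorem proposition3p3 {F : Type*} [Field F] (n : ℕ) (N : Fin n → ℕ) (hN : ∀ i, 0 < N i)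
    (lam : Fin n → ℕ → Fin n → F) :
    ∃ φ : SplitCI.SplitAlgebra N lam →ₐ[F] SplitCI.QuadAlgebra N hN lam,
      (∀ i : Fin n, φ (Ideal.Quotient.mk (SplitCI.splitIdeal N lam) (MvPolynomial.X i)) =
        Ideal.Quotient.mk (SplitCI.quadIdeal N hN lam)
          (MvPolynomial.X (SplitCI.lastIndex N hN i))) ∧
      (IsArtinianRing (SplitCI.SplitAlgebra N lam) →
        IsArtinianRing (SplitCI.QuadAlgebra N hN lam) ∧
        SplitCI.IsQuadraticCompleteIntersection (SplitCI.quadForm N hN lam) ∧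
        SplitCI.IsSocleGenerator (SplitCI.prodLinForm N hN lam) ∧
        (∀ s : SplitCI.SplitAlgebra N lam, SplitCI.IsSocleGenerator s →
          ∃ c : F, c ≠ 0 ∧ φ s = c • SplitCI.prodLinForm N hN lam) ∧
        SplitCI.IsEmbedding φ ∧ Function.Injective φ) := by
  open MvPolynomial SplitCI in
  classical
  let φ : SplitAlgebra N lam →ₐ[F] QuadAlgebra N hN lam :=
    Ideal.quotientMapₐ (quadIdeal N hN lam) (lastRename N hN F)
      fun y hy => lastRename_mem_quadIdeal hN hy
  have hφ : ∀ y, φ (Ideal.Quotient.mk _ y) = Ideal.Quotient.mk _ (lastRename N hN F y) :=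
    fun _ => rfl
  have hinj : Function.Injective φ := by
    rw [injective_iff_map_eq_zero]
    intro y hy
    obtain ⟨y, rfl⟩ := Ideal.Quotient.mk_surjective y
    rw [hφ, Ideal.Quotient.eq_zero_iff_mem] at hy
    exact Ideal.Quotient.eq_zero_iff_mem.2 (mem_splitIdeal_of_lastRename_mem hN hy)
  refine ⟨φ, fun i => by rw [hφ, lastRename_X], fun hA => ?_⟩
  have hreg := isSplitRegular_linForm (lam := lam) hN
  have hhom : ∀ p, (linForm N hN lam p).IsHomogeneous 1 := fun p =>
    isHomogeneous_one_of_mem_span_X (linForm_mem_span_X hN p)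
  have hsocA := (isSplitRegular_splitCofactor (lam := lam) (N := N)).isSocleGenerator
  have hsoc : IsSocleGenerator (prodLinForm N hN lam) := hreg.isSocleGenerator
  -- The image of the socle generator of `A` has degree `∑ N i`, the top degree of `Â`.
  have hmem : φ (Ideal.Quotient.mk (splitIdeal N lam) (∏ i, splitCofactor N lam i)) ∈
      socle (quadIdeal N hN lam) := by
    rw [hφ, mem_socle_mk_iff]
    intro q
    refine hreg.mem_of_lt_degree (d := fun _ => 1) hhom (X_mem_radical_quadIdeal hN)
      (e := 1 + ∑ i, N i) ?_ ((isHomogeneous_X F q).mul ?_)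
    · simp
    · exact IsHomogeneous.rename_isHomogeneous
        (IsHomogeneous.prod _ _ _ fun i _ => isHomogeneous_splitCofactor i)
  have hmain : ∀ s : SplitAlgebra N lam, IsSocleGenerator s →
      ∃ c : F, c ≠ 0 ∧ φ s = c • prodLinForm N hN lam := by
    intro s hs
    obtain ⟨b, hb, hbs⟩ := IsSocleGenerator.exists_smul_eq hsocA hs
    rw [hsoc.2, Submodule.mem_span_singleton] at hmem
    obtain ⟨c, hc⟩ := hmem
    have hφs : φ s = (b * c) • prodLinForm N hN lam := by
      rw [mul_smul, hc, hbs]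
      exact map_smul φ b _
    refine ⟨b * c, fun h0 => hs.1 ?_, hφs⟩
    rw [h0, zero_smul] at hφs
    exact (map_eq_zero_iff φ hinj).1 hφs
  refine ⟨isArtinianRing_of_X_mem_radical (X_mem_radical_quadIdeal hN),
    hreg.isQuadraticCompleteIntersection hhom, hsoc, hmain, ⟨?_, ?_⟩, hinj⟩
  · rintro d _ ⟨y, hy, rfl⟩
    refine ⟨lastRename N hN F y, ?_, rfl⟩
    exact (mem_homogeneousSubmodule _ _).2
      (IsHomogeneous.rename_isHomogeneous ((mem_homogeneousSubmodule _ _).1 hy))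
  · refine ⟨_, hsocA, ?_⟩
    obtain ⟨c, hc, h⟩ := hmain _ hsocA
    exact h ▸ hsoc.smul hc
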